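/- For $z$ in the upper half-plane $\mathbb{H}$ write $e(z)=e^{2\pi i z}$, let $\Gamma_\infty=\left\{\begin{pmatrix}1&b\\0&1\end{pmatrix}: b\in\mathbb{Z}\right\}$, and for a positive even integer $k$ and an integer $m\ge 1$ let $$P_{k,m,1}(z)=\sum_{\gamma\in\Gamma_\infty\backslash \mathrm{SL}_2(\mathbb{Z})} j(\gamma,z)^{-k}\,e(m\,\gamma z),\qquad j\left(\begin{pmatrix}a&b\\c&d\end{pmatrix},z\right)=cz+d,$$ be the Poincaré series of weight $k$ and index $m$ of level one. Let $v_\infty(f)$ denote the order of vanishing of $f$ at the cusp $i\infty$, that is, the least exponent $n$ for which $e(nz)$ has a non-zero coefficient in the Fourier expansion of $f$. There is an absolute constant $k_0$ such that for every even integer $k\ge k_0$ and every integer $m$ with $$1\le m\le \frac{(k-1)^2}{16\pi^2},$$ the series defining $P_{k,m,1}(z)$ converges absolutely for every $z\in\mathbb{H}$ and $$v_\infty\left(P_{k,m,1}\right)=1;$$ in particular $P_{k,m,1}\not\equiv 0$. -/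

import Mathlib

open scoped MatrixGroups UpperHalfPlane

noncomputable section

namespace PoincareSeries

/-- `e(z) = exp(2πiz)`. -/
def e (z : ℂ) : ℂ := Complex.exp (2 * Real.pi * Complex.I * z)

/-- The group `Γ_∞` of integral matrices `(1, *; 0, 1)`. It does not contain `-I`. -/
def GammaInfty : Subgroup SL(2, ℤ) where
  carrier := {γ | γ 0 0 = 1 ∧ γ 1 0 = 0 ∧ γ 1 1 = 1}
  one_mem' := by simp
  mul_mem' := by
    rintro a b ⟨ha, ha', ha''⟩ ⟨hb, hb', hb''⟩
    simp [Matrix.mul_apply, Fin.sum_univ_two, *]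
  inv_mem' := by
    rintro a ⟨ha, ha', ha''⟩
    simp [Matrix.SpecialLinearGroup.coe_inv, Matrix.adjugate_fin_two, *]

/-- The automorphy factor `j(γ, z) = cz + d`. -/
def j (γ : SL(2, ℤ)) (z : ℍ) : ℂ := (γ 1 0 : ℂ) * z + (γ 1 1 : ℂ)

/-- The summand `j(γ, z)^{-k} e(m γz)`. -/
def term (k m : ℕ) (z : ℍ) (γ : SL(2, ℤ)) : ℂ :=
  j γ z ^ (-(k : ℤ)) * e (m * ((γ • z : ℍ) : ℂ))

/-- The summand depends only on the coset `Γ_∞ γ`. -/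
theorem term_mul_left (k m : ℕ) (z : ℍ) {u : SL(2, ℤ)} (hu : u ∈ GammaInfty) (γ : SL(2, ℤ)) :
    term k m z (u * γ) = term k m z γ := by
  obtain ⟨h00, h10, h11⟩ := hu
  have hj : j (u * γ) z = j γ z := by
    simp [j, Matrix.mul_apply, Fin.sum_univ_two, *]
  have hact : (((u * γ) • z : ℍ) : ℂ) = ((γ • z : ℍ) : ℂ) + (u 0 1 : ℤ) := by
    rw [mul_smul, UpperHalfPlane.specialLinearGroup_apply]
    simp [h00, h10, h11]
  have he : e (m * ((γ • z : ℍ) + (u 0 1 : ℤ) : ℂ)) = e (m * ((γ • z : ℍ) : ℂ)) := by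
    unfold e
    rw [Complex.exp_eq_exp_iff_exists_int]
    exact ⟨m * u 0 1, by push_cast; ring⟩
  rw [term, term, hj, hact, he]

/-- The coset space `Γ_∞ \ Γ₀(N)`, that is, the set of cosets `Γ_∞ γ` with `γ ∈ Γ₀(N)`. -/
abbrev Cosets (N : ℕ) : Type :=
  Quotient (QuotientGroup.rightRel (GammaInfty.subgroupOf (CongruenceSubgroup.Gamma0 N)))

/-- The summand as a function on `Γ_∞ \ Γ₀(N)`. -/
def cosetTerm (k m N : ℕ) (z : ℍ) : Cosets N → ℂ :=
  Quotient.lift (fun γ : CongruenceSubgroup.Gamma0 N => term k m z (γ : SL(2, ℤ))) (by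
    intro a b hab
    have h : b * a⁻¹ ∈ GammaInfty.subgroupOf (CongruenceSubgroup.Gamma0 N) :=
      QuotientGroup.rightRel_apply.mp hab
    have h' : (b : SL(2, ℤ)) * (a : SL(2, ℤ))⁻¹ ∈ GammaInfty := by
      simpa [Subgroup.mem_subgroupOf] using h
    have := term_mul_left k m z h' (a : SL(2, ℤ))
    simpa using this.symm)

/-- The Poincaré series `P_{k,m,N}(z)` of weight `k` and index `m` for `Γ₀(N)`. -/
def P (k m N : ℕ) (z : ℍ) : ℂ := ∑' γ : Cosets N, cosetTerm k m N z γ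

/-- The order of vanishing at the cusp `i∞` of a `1`-periodic function on the upper half plane:
the least exponent with non-zero coefficient in its expansion in powers of `q = e(z)`
(and `⊤` if there is none). -/
def vInfty (f : ℍ → ℂ) : ℕ∞ := (UpperHalfPlane.qExpansion 1 f).order

end PoincareSeries

end

/-! ### q-expansions from convergent Fourier expansions -/

section
open Complex UpperHalfPlane Function Filter Topology

namespace PoincareSeries

/-! Put `ν = k - 1`. Sorting cosets by bottom row `(c, d)` and applying Lipschitz' formula to each
`c ≠ 0` gives the Fourier expansion of the Poincaré series (`hasSum_P`): its `n`-th coefficient is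
`2δ_{mn}` plus Kloosterman sums times Bessel values. A factor `n ^ ν` kills the constant
coefficient, so everything rests on the coefficient of `e(z)`.

There, with `K = (2π)^(ν+1)/ν!`, the terms `c = ±1` have trivial Kloosterman sum and together have
absolute value `2K G`, where `G = besselG ν (4π²m)` is a normalized Bessel value. The hypothesis on
`m` puts the Bessel argument `4π√m` at most `ν`, where `√2 · 2^(-ν) ≤ G ≤ 1` (`besselG_bounds`,
`le_besselG`). The terms with `|c| ≥ 2` add up to at most `2.64 K 2^(-ν)`, by the trivial
Kloosterman bound and `ζ(4)`. For `m ≠ 1` the terms `c = ±1` win, since `2 · 1.4 > 2.64`. For `m =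
1` the diagonal term `2` wins, because `K → 0`. -/

theorem hasSum_cuspFunction_of_hasSum {f : ℍ → ℂ} {c : ℕ → ℂ}
    (hf : ∀ τ : ℍ, HasSum (fun n ↦ c n * e τ ^ n) (f τ)) {q : ℂ} (hq : ‖q‖ < 1) (hq0 : q ≠ 0) :
    HasSum (fun n ↦ c n * q ^ n) (cuspFunction 1 f q) := by
  have h1 := Periodic.im_invQParam_pos_of_norm_lt_one one_pos hq hq0
  let τ : ℍ := ⟨Periodic.invQParam 1 q, h1⟩
  have h2 := Periodic.cuspFunction_eq_of_nonzero 1 (f ∘ ofComplex) hq0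
  have h3 : cuspFunction 1 f q = f τ := by
    simpa [UpperHalfPlane.ofComplex_apply_of_im_pos h1] using! h2
  have h4 : e τ = q := by
    rw [← Periodic.qParam_right_inv (h := 1) one_ne_zero hq0]
    simp [e, Periodic.qParam, τ]
  rw [h3, ← h4]
  exact hf τ

/-- The value of `cuspFunction` at `0` is defined as a limit, so it is first overwritten by the
expected value; continuity of the resulting power series then shows that nothing was changed. -/
theorem hasFPowerSeriesOnBall_update_cuspFunction {f : ℍ → ℂ} {c : ℕ → ℂ}
    (hf : ∀ τ : ℍ, HasSum (fun n ↦ c n * e τ ^ n) (f τ)) :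
    HasFPowerSeriesOnBall (update (cuspFunction 1 f) 0 (c 0)) (.ofScalars ℂ c) 0 1 := by
  constructor
  · refine le_of_forall_lt_imp_le_of_dense fun r hr ↦ ?_
    rcases eq_or_ne r 0 with rfl | hr'
    · simp
    · lift r to NNReal using hr.ne_top
      apply FormalMultilinearSeries.le_radius_of_summable
      simpa [norm_mul, mul_comm, mul_left_comm, mul_assoc] using
        (hasSum_cuspFunction_of_hasSum hf (q := r) (by simpa using hr)
          (mod_cast hr')).summable.norm
  · simp
  · intro y hy
    rw [← ENNReal.coe_one, Metric.eball_coe, NNReal.coe_one, mem_ball_zero_iff] at hy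
    rcases eq_or_ne y 0 with rfl | hy'
    · simpa +contextual [zero_pow_eq] using hasSum_ite_eq 0 (c 0)
    · simpa [update_of_ne hy', mul_comm] using hasSum_cuspFunction_of_hasSum hf hy hy'

theorem cuspFunction_zero_of_hasSum {f : ℍ → ℂ} {c : ℕ → ℂ}
    (hf : ∀ τ : ℍ, HasSum (fun n ↦ c n * e τ ^ n) (f τ)) : cuspFunction 1 f 0 = c 0 := by
  have H := (hasFPowerSeriesOnBall_update_cuspFunction hf).hasFPowerSeriesAt.continuousAt.tendsto
  rw [update_self] at H
  have h1 := (H.mono_left (nhdsWithin_le_nhds (s := {0}ᶜ))).congr' (f₂ := cuspFunction 1 f) (by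
    filter_upwards [self_mem_nhdsWithin] with a ha using update_of_ne ha ..)
  have h2 := Periodic.cuspFunction_zero_eq_limUnder_nhds_ne 1 (f ∘ ofComplex)
  exact h2.trans h1.limUnder_eq

theorem qExpansion_coeff_of_hasSum {f : ℍ → ℂ} {c : ℕ → ℂ}
    (hf : ∀ τ : ℍ, HasSum (fun n ↦ c n * e τ ^ n) (f τ)) (n : ℕ) :
    (qExpansion 1 f).coeff n = c n := by
  have H := (hasFPowerSeriesOnBall_update_cuspFunction hf).hasFPowerSeriesAt
  rw [update_eq_self_iff.mpr (cuspFunction_zero_of_hasSum hf).symm] at H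
  have h2 := H.eq_formalMultilinearSeries H.analyticAt.hasFPowerSeriesAt
  simpa [qExpansion_coeff, div_eq_mul_inv, mul_comm] using
    (congr_arg (FormalMultilinearSeries.coeff · n) h2).symm

end PoincareSeries
end

/-! ### Bounds for Bessel functions below the transition range -/

section
open Filter Topology
open scoped Nat

namespace PoincareSeries

/-- The entire function `∑ sʲ / (j! (ν + j)!)`, so that `J_ν(x) = (x/2)^ν besselF ν (-x²/4)`. -/
noncomputable def besselF (ν : ℕ) (s : ℂ) : ℂ := ∑' j : ℕ, s ^ j / (j ! * (ν + j)! : ℂ)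

/-- The normalized real function `ν! ∑ (-t)ʲ / (j! (ν + j)!)`. -/
noncomputable def besselG (ν : ℕ) (t : ℝ) : ℝ := ∑' j : ℕ, (-t) ^ j * (ν ! / (j ! * (ν + j)!))

theorem factorial_div_le (ν j : ℕ) : (ν ! : ℝ) / (ν + j)! ≤ (1 / (ν + 1)) ^ j := by
  rw [div_le_iff₀ (by positivity), div_pow, one_pow, one_div, inv_mul_eq_div,
    le_div_iff₀ (by positivity)]
  exact_mod_cast Nat.factorial_mul_pow_le_factorial

theorem norm_besselG_term_le (ν : ℕ) (t : ℝ) (j : ℕ) :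
    ‖(-t) ^ j * (ν ! / (j ! * (ν + j)!) : ℝ)‖ ≤ (|t| / (ν + 1)) ^ j / j ! := by
  have h : ‖(-t) ^ j * (ν ! / (j ! * (ν + j)!) : ℝ)‖
      = |t| ^ j / j ! * ((ν ! : ℝ) / (ν + j)!) := by
    rw [norm_mul, norm_pow, norm_neg, Real.norm_eq_abs, Real.norm_of_nonneg (by positivity)]
    field_simp
  rw [h]
  calc _ ≤ |t| ^ j / j ! * (1 / (ν + 1)) ^ j := by
        gcongr; exact factorial_div_le ν j
    _ = _ := by simp only [div_pow, one_pow]; ring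

theorem summable_besselG (ν : ℕ) (t : ℝ) :
    Summable fun j : ℕ ↦ (-t) ^ j * (ν ! / (j ! * (ν + j)!) : ℝ) :=
  .of_norm_bounded (Real.summable_pow_div_factorial _) (norm_besselG_term_le ν t)

/-- The three-term Bessel recurrence in this normalization. The `j = 0` terms of the first two
series are both `1` and cancel; the rest is compared coefficientwise after a shift of index. -/
theorem besselG_eq_sub (ν : ℕ) (t : ℝ) :
    besselG ν t = besselG (ν + 1) t - t / ((ν + 1) * (ν + 2)) * besselG (ν + 2) t := by
  have h1 := (summable_besselG ν t).hasSum
  have h2 := (summable_besselG (ν + 1) t).hasSum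
  have h3 := ((summable_besselG (ν + 2) t).hasSum).mul_left (t / ((ν + 1) * (ν + 2)))
  have h4 := h1.sub h2
  have h5 : HasSum (fun j : ℕ ↦ (-t) ^ (j + 1) * (ν ! / ((j + 1)! * (ν + (j + 1))!) : ℝ)
      - (-t) ^ (j + 1) * ((ν + 1)! / ((j + 1)! * (ν + 1 + (j + 1))!) : ℝ))
      (besselG ν t - besselG (ν + 1) t) := by
    have := (hasSum_nat_add_iff' (f := fun j : ℕ ↦ (-t) ^ j * (ν ! / (j ! * (ν + j)!) : ℝ)
      - (-t) ^ j * ((ν + 1)! / (j ! * (ν + 1 + j)!) : ℝ)) 1).mpr h4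
    simp only [Finset.range_one, Finset.sum_singleton, pow_zero, Nat.factorial_zero, add_zero] at this
    have e1 : ((ν ! : ℝ) / ((1 : ℕ) * ν !)) = 1 := by field_simp; simp
    have e2 : (((ν + 1)! : ℝ) / ((1 : ℕ) * (ν + 1)!)) = 1 := by field_simp; simp
    rw [e1, e2] at this
    simpa [besselG] using this
  have h6 := h5.add h3
  have h7 : ∀ j : ℕ, (-t) ^ (j + 1) * (ν ! / ((j + 1)! * (ν + (j + 1))!) : ℝ)
      - (-t) ^ (j + 1) * ((ν + 1)! / ((j + 1)! * (ν + 1 + (j + 1))!) : ℝ)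
      + t / ((ν + 1) * (ν + 2)) * ((-t) ^ j * ((ν + 2)! / (j ! * (ν + 2 + j)!) : ℝ)) = 0 := by
    intro j
    rw [show ν + 1 + (j + 1) = (ν + (j + 1)) + 1 by ring, show ν + 2 + j = (ν + (j + 1)) + 1 by ring,
      Nat.factorial_succ (ν + (j + 1)), Nat.factorial_succ (ν + 1), Nat.factorial_succ ν,
      Nat.factorial_succ j]
    push_cast
    have : (ν : ℝ) + (j + 1) + 1 ≠ 0 := by positivity
    field_simp
    ring
  simp only [h7] at h6
  have := h6.unique hasSum_zero
  have h8 : besselG (ν + 2) t = ∑' j : ℕ, (-t) ^ j * ((ν + 2)! / (j ! * (ν + 2 + j)!) : ℝ) := rfl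
  rw [← h8] at this
  linarith

theorem tendsto_besselG (t : ℝ) : Tendsto (fun ν ↦ besselG ν t) atTop (𝓝 1) := by
  have hb : ∀ ν : ℕ, |besselG ν t - 1| ≤ Real.exp (|t| / (ν + 1)) - 1 := by
    intro ν
    have h1 := (summable_besselG ν t).hasSum
    have h2 := NormedSpace.expSeries_div_hasSum_exp (|t| / (ν + 1))
    rw [← Real.exp_eq_exp_ℝ] at h2
    have h1' := (hasSum_nat_add_iff' 1).mpr h1
    have h2' := (hasSum_nat_add_iff' 1).mpr h2
    simp only [Finset.range_one, Finset.sum_singleton, pow_zero, Nat.factorial_zero, add_zero,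
      Nat.cast_one, div_one] at h1' h2'
    have := tsum_of_norm_bounded h2' (fun j ↦ norm_besselG_term_le ν t (j + 1))
    rwa [h1'.tsum_eq, one_mul, one_mul, div_self (by positivity), ← besselG] at this
  have h0 : Tendsto (fun ν : ℕ ↦ Real.exp (|t| / (ν + 1)) - 1) atTop (𝓝 0) := by
    have h1 : Tendsto (fun ν : ℕ ↦ |t| / ((ν : ℝ) + 1)) atTop (𝓝 0) :=
      tendsto_const_nhds.div_atTop (tendsto_natCast_atTop_atTop.atTop_add tendsto_const_nhds)
    simpa using (Real.continuous_exp.tendsto 0).comp h1 |>.sub_const 1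
  rw [tendsto_iff_norm_sub_tendsto_zero]
  exact squeeze_zero (fun _ ↦ norm_nonneg _) hb h0

/-- Downward induction on the order, starting where the values are close to their limit `1`. If
`G_{μ+2} ≤ 2 G_{μ+1}`, the recurrence gives `G_μ ≥ (1 - 2u) G_{μ+1}` with `u = t/((μ+1)(μ+2)) ≤
1/4`, so the factor `2` reproduces itself. -/
theorem besselG_pos_and_le {ν : ℕ} {t : ℝ} (ht0 : 0 ≤ t) (ht : 4 * t ≤ (ν + 1) * (ν + 2)) :
    0 < besselG (ν + 1) t ∧ besselG (ν + 1) t ≤ 2 * besselG ν t := by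
  have hlim := tendsto_besselG t
  have e1 : ∀ᶠ μ in atTop, 3 / 4 < besselG μ t ∧ besselG μ t < 5 / 4 :=
    (hlim.eventually (lt_mem_nhds (by norm_num))).and (hlim.eventually (gt_mem_nhds (by norm_num)))
  obtain ⟨N, hN⟩ := eventually_atTop.mp e1
  have hbig : ∀ μ, N ≤ μ → 0 < besselG (μ + 1) t ∧ besselG (μ + 1) t ≤ 2 * besselG μ t := by
    intro μ hμ
    have h1 := hN μ hμ
    have h2 := hN (μ + 1) (by lia)
    constructor <;> linarith
  have step : ∀ μ, ν ≤ μ → (0 < besselG (μ + 2) t ∧ besselG (μ + 2) t ≤ 2 * besselG (μ + 1) t) →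
      0 < besselG (μ + 1) t ∧ besselG (μ + 1) t ≤ 2 * besselG μ t := by
    rintro μ hμ ⟨h1, h2⟩
    have hpos : 0 < besselG (μ + 1) t := by linarith
    refine ⟨hpos, ?_⟩
    have hrec := besselG_eq_sub μ t
    have hμ' : (ν : ℝ) ≤ μ := by exact_mod_cast hμ
    have hu : t / ((μ + 1) * (μ + 2)) ≤ 1 / 4 := by
      rw [div_le_iff₀ (by positivity)]
      nlinarith
    have hu0 : 0 ≤ t / ((μ + 1) * (μ + 2) : ℝ) := by positivity
    nlinarith
  have key : ∀ n μ, ν ≤ μ → N ≤ μ + n →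
      0 < besselG (μ + 1) t ∧ besselG (μ + 1) t ≤ 2 * besselG μ t := by
    intro n
    induction n with
    | zero => exact fun μ _ h ↦ hbig μ h
    | succ n ih => exact fun μ hμ h ↦ step μ hμ (ih (μ + 1) (by lia) (by lia))
  exact key N ν le_rfl (by lia)

/-- Convexity of the exponential: the right side is the chord through `u = 0` and `u = 1/2`. -/
theorem two_rpow_neg_two_mul_le {u : ℝ} (h0 : 0 ≤ u) (h1 : u ≤ 1 / 2) :
    (2 : ℝ) ^ (-(2 * u)) ≤ 1 - u := by
  have := Real.geom_mean_le_arith_mean2_weighted (w₁ := 1 - 2 * u) (w₂ := 2 * u) (p₁ := 1)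
    (p₂ := 1 / 2) (by linarith) (by linarith) (by norm_num) (by norm_num) (by ring)
  rw [Real.one_rpow, one_mul, one_div, Real.inv_rpow (by norm_num), ← Real.rpow_neg (by norm_num)]
    at this
  linarith

/-- The ratio of consecutive orders lies between `2^(-4u)` and `1`, where `u = t/((μ+1)(μ+2))`.
These exponents telescope to `4t/(ν+1)`, and the limit in the order is `1`. -/
theorem besselG_bounds {ν : ℕ} {t : ℝ} (ht0 : 0 ≤ t) (ht : 4 * t ≤ (ν + 1) * (ν + 2)) :
    (2 : ℝ) ^ (-(4 * t / (ν + 1))) ≤ besselG ν t ∧ besselG ν t ≤ 1 := by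
  have hall : ∀ n : ℕ, 4 * t ≤ ((ν + n : ℕ) + 1) * ((ν + n : ℕ) + 2) := fun n ↦ by
    push_cast; nlinarith [show (0 : ℝ) ≤ n from n.cast_nonneg, show (0 : ℝ) ≤ ν from ν.cast_nonneg]
  have hlim : Tendsto (fun n ↦ besselG (ν + n) t) atTop (𝓝 1) := by
    simpa [add_comm] using (tendsto_add_atTop_iff_nat ν).mpr (tendsto_besselG t)
  have hu : ∀ n : ℕ, (0 : ℝ) ≤ 2 * t / (((ν + n : ℕ) + 1) * ((ν + n : ℕ) + 2)) ∧
      2 * t / (((ν + n : ℕ) + 1 : ℝ) * ((ν + n : ℕ) + 2)) ≤ 1 / 2 := fun n ↦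
    ⟨by positivity, by rw [div_le_iff₀ (by positivity)]; linarith [hall n]⟩
  have hstep : ∀ n : ℕ, (1 - 2 * t / (((ν + n : ℕ) + 1) * ((ν + n : ℕ) + 2))) * besselG (ν + n + 1) t
      ≤ besselG (ν + n) t ∧ besselG (ν + n) t ≤ besselG (ν + n + 1) t ∧
      0 < besselG (ν + n + 1) t := by
    intro n
    obtain ⟨p1, -⟩ := besselG_pos_and_le ht0 (hall n)
    obtain ⟨p2, p3⟩ := besselG_pos_and_le (ν := ν + n + 1) ht0 (hall (n + 1))
    have hrec := besselG_eq_sub (ν + n) t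
    obtain ⟨u0, u1⟩ := hu n
    rw [mul_div_assoc] at u0 u1 ⊢
    set u := t / (((ν + n : ℕ) + 1 : ℝ) * ((ν + n : ℕ) + 2))
    refine ⟨?_, ?_, p1⟩
    · rw [hrec]; nlinarith
    · rw [hrec]; nlinarith [mul_nonneg u0 p2.le]
  constructor
  · have hanti : Antitone fun n : ℕ ↦ besselG (ν + n) t * (2 : ℝ) ^ (4 * t / ((ν + n : ℕ) + 1)) := by
      refine antitone_nat_of_succ_le fun n ↦ ?_
      obtain ⟨h1, -, h3⟩ := hstep n
      have h4 := two_rpow_neg_two_mul_le (hu n).1 (hu n).2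
      have h5 : (4 * t / ((ν + (n + 1) : ℕ) + 1 : ℝ)) =
          -(2 * (2 * t / (((ν + n : ℕ) + 1) * ((ν + n : ℕ) + 2)))) + 4 * t / ((ν + n : ℕ) + 1) := by
        push_cast
        field_simp
        ring
      rw [h5, Real.rpow_add (by norm_num), ← mul_assoc]
      gcongr
      refine le_trans ?_ h1
      rw [mul_comm, ← add_assoc]
      gcongr
    have hl : Tendsto (fun n : ℕ ↦ besselG (ν + n) t * (2 : ℝ) ^ (4 * t / ((ν + n : ℕ) + 1)))
        atTop (𝓝 1) := by
      have h1 : Tendsto (fun n : ℕ ↦ 4 * t / ((ν + n : ℕ) + 1 : ℝ)) atTop (𝓝 0) := by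
        refine tendsto_const_nhds.div_atTop (Tendsto.atTop_add ?_ tendsto_const_nhds)
        exact tendsto_natCast_atTop_atTop.comp (tendsto_atTop_mono (fun n ↦ Nat.le_add_left n ν) tendsto_id)
      have h2 := (Real.continuous_const_rpow (a := 2) (by norm_num)).tendsto 0 |>.comp h1
      simpa using hlim.mul h2
    have h := hanti.le_of_tendsto hl 0
    simp only [add_zero] at h
    rwa [Real.rpow_neg (by norm_num), inv_le_iff_one_le_mul₀ (by positivity)]
  · have hmono : Monotone fun n ↦ besselG (ν + n) t :=
      monotone_nat_of_le_succ fun n ↦ (hstep n).2.1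
    simpa using hmono.ge_of_tendsto hlim 0

theorem besselF_neg_ofReal (ν : ℕ) (t : ℝ) : besselF ν (-t) = (besselG ν t / ν ! : ℝ) := by
  rw [besselF, besselG, ← tsum_div_const, Complex.ofReal_tsum]
  refine tsum_congr fun j ↦ ?_
  have h : (ν ! : ℂ) ≠ 0 := by exact_mod_cast ν.factorial_ne_zero
  push_cast
  field_simp

/-- The free `ε` matters: with `s` proportional to `n`, the growth `exp(ε|s|)` must be beaten by
`|e(z)|^n` for every `z` in the upper half-plane. -/
theorem norm_besselF_term_le (ν : ℕ) (s : ℂ) {ε : ℝ} (hε : 0 < ε) (j : ℕ) :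
    ‖s ^ j / (j ! * (ν + j)! : ℂ)‖ ≤ (1 / ε) ^ j / j ! * Real.exp (ε * ‖s‖) := by
  have h1 : (j ! : ℝ) ≤ (ν + j)! := by exact_mod_cast Nat.factorial_le (by lia)
  have h2 := Real.pow_div_factorial_le_exp (ε * ‖s‖) (by positivity) j
  calc ‖s ^ j / (j ! * (ν + j)! : ℂ)‖ = ‖s‖ ^ j / (j ! * (ν + j)!) := by simp
    _ ≤ ‖s‖ ^ j / (j ! * j !) := by gcongr
    _ = (1 / ε) ^ j / j ! * ((ε * ‖s‖) ^ j / j !) := by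
        rw [mul_pow, div_pow, one_pow]; field_simp
    _ ≤ _ := by gcongr

theorem norm_besselF_le (ν : ℕ) (s : ℂ) {ε : ℝ} (hε : 0 < ε) :
    ‖besselF ν s‖ ≤ Real.exp (1 / ε) * Real.exp (ε * ‖s‖) := by
  have h := NormedSpace.expSeries_div_hasSum_exp (1 / ε)
  rw [← Real.exp_eq_exp_ℝ] at h
  exact tsum_of_norm_bounded (h.mul_right _) (norm_besselF_term_le ν s hε)

end PoincareSeries
end

/-! ### Lipschitz' formula with an exponential factor -/

section
open Filter Topology Complex
open scoped Nat

namespace PoincareSeries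

theorem norm_e_lt_one (w : ℍ) : ‖e w‖ < 1 := UpperHalfPlane.norm_exp_two_pi_I_lt_one w

theorem norm_e (z : ℂ) : ‖e z‖ = Real.exp (-(2 * Real.pi * z.im)) := by
  rw [e, Complex.norm_exp]
  congr 1
  simp [mul_assoc]

theorem exists_pos_exp_mul_lt_one {a r : ℝ} (hr : r < 1) :
    ∃ ε : ℝ, 0 < ε ∧ Real.exp (ε * a) * r < 1 := by
  have h1 : Tendsto (fun ε : ℝ ↦ Real.exp (ε * a) * r) (𝓝[>] 0) (𝓝 r) := by
    have : Continuous fun ε : ℝ ↦ Real.exp (ε * a) * r := by fun_prop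
    simpa using (this.tendsto 0).mono_left nhdsWithin_le_nhds
  obtain ⟨ε, h2, h3⟩ := ((h1.eventually (gt_mem_nhds hr)).and self_mem_nhdsWithin).exists
  exact ⟨ε, h3, h2⟩

theorem summable_inv_add_int_pow (w : ℂ) {k : ℕ} (hk : 2 ≤ k) :
    Summable fun l : ℤ ↦ ((w + l) ^ k)⁻¹ := by
  simpa using EisensteinSeries.linear_right_summable w 1 (k := k) (by exact_mod_cast hk)

theorem im_le_norm_add_int (w : ℍ) (l : ℤ) : w.im ≤ ‖(w : ℂ) + l‖ := by
  simpa using (le_abs_self _).trans (Complex.abs_im_le_norm ((w : ℂ) + l))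

theorem summable_inv_pow_mul_pow_div_factorial (w : ℍ) (A : ℂ) {k : ℕ} (hk : 2 ≤ k) :
    Summable fun p : ℤ × ℕ ↦ (((w : ℂ) + p.1) ^ k)⁻¹ * ((A / (w + p.1)) ^ p.2 / p.2 !) := by
  have hs := (summable_inv_add_int_pow w hk).norm.mul_of_nonneg
    (Real.summable_pow_div_factorial (‖A‖ / w.im)) (fun _ ↦ norm_nonneg _)
    (fun j ↦ div_nonneg (pow_nonneg (div_nonneg (norm_nonneg _) w.im_pos.le) _) (by positivity))
  refine Summable.of_norm_bounded hs fun ⟨l, j⟩ ↦ ?_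
  rw [norm_mul, norm_div, norm_pow (A / _), norm_div A, Complex.norm_natCast]
  have := w.im_pos
  gcongr
  exact im_le_norm_add_int w l

theorem summable_lipschitz_bessel (ν : ℕ) (w : ℍ) (A : ℂ) :
    Summable fun p : ℕ × ℕ ↦ A ^ p.1 / p.1 ! *
      ((-2 * Real.pi * I) ^ (ν + p.1 + 1) / (ν + p.1)! * (p.2 ^ (ν + p.1) * e w ^ p.2)) := by
  obtain ⟨ε, hε, hlt⟩ := exists_pos_exp_mul_lt_one (a := ‖-2 * Real.pi * I * A‖) (norm_e_lt_one w)
  have h2 : Summable fun n : ℕ ↦ (n : ℝ) ^ ν * (Real.exp (ε * ‖-2 * Real.pi * I * A‖) * ‖e w‖) ^ n :=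
    summable_pow_mul_geometric_of_norm_lt_one ν
      (by rwa [Real.norm_of_nonneg (by positivity)])
  have hs := ((Real.summable_pow_div_factorial (1 / ε)).mul_of_nonneg h2
    (fun _ ↦ by positivity) (fun _ ↦ by positivity)).mul_left (‖-2 * Real.pi * I‖ ^ (ν + 1))
  refine Summable.of_norm_bounded hs fun ⟨j, n⟩ ↦ ?_
  have h3 := norm_besselF_term_le ν (-2 * Real.pi * I * A * n) hε j
  have h4 : A ^ j / j ! *
      ((-2 * Real.pi * I) ^ (ν + j + 1) / (ν + j)! * (n ^ (ν + j) * e w ^ n)) =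
      (-2 * Real.pi * I) ^ (ν + 1) * (n ^ ν * ((-2 * Real.pi * I * A * n) ^ j / (j ! * (ν + j)! : ℂ))
        * e w ^ n) := by
    rw [mul_pow _ (n : ℂ), mul_pow _ A, pow_add _ ν j, show ν + j + 1 = ν + 1 + j by ring,
      pow_add _ (ν + 1) j]
    field_simp
  rw [h4]
  generalize -2 * (Real.pi : ℂ) * I = κ at *
  rw [norm_mul, norm_pow, norm_mul, norm_mul, norm_pow, norm_pow, Complex.norm_natCast]
  refine mul_le_mul_of_nonneg_left ?_ (by positivity)
  have h5 : Real.exp (ε * ‖κ * A * n‖) = Real.exp (ε * ‖κ * A‖) ^ n := by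
    rw [norm_mul _ (n : ℂ), Complex.norm_natCast, ← Real.exp_nat_mul]; ring_nf
  rw [h5] at h3
  calc _ ≤ (n : ℝ) ^ ν * ((1 / ε) ^ j / j ! * Real.exp (ε * ‖κ * A‖) ^ n) * ‖e w‖ ^ n := by
        gcongr
    _ = _ := by rw [mul_pow]; ring

/-- Lipschitz' formula for `w ↦ w⁻ᵏ exp(A / w)`. -/
theorem tsum_inv_pow_mul_exp_div {ν : ℕ} (hν : 1 ≤ ν) (w : ℍ) (A : ℂ) :
    ∑' l : ℤ, (((w : ℂ) + l) ^ (ν + 1))⁻¹ * exp (A / (w + l)) =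
      ∑' n : ℕ, (-2 * Real.pi * I) ^ (ν + 1) * (n ^ ν * besselF ν (-2 * Real.pi * I * A * n)
        * e w ^ n) := by
  have h1 : ∀ l : ℤ, (((w : ℂ) + l) ^ (ν + 1))⁻¹ * exp (A / (w + l)) =
      ∑' j : ℕ, (((w : ℂ) + l) ^ (ν + 1))⁻¹ * ((A / (w + l)) ^ j / j !) := fun l ↦ by
    rw [tsum_mul_left, Complex.exp_eq_exp_ℂ, NormedSpace.exp_eq_tsum_div]
  have hs1 := summable_inv_pow_mul_pow_div_factorial w A (k := ν + 1) (by lia)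
  -- With the exponential expanded, the `j`-th term is the classical Lipschitz formula of exponent
  -- `ν + 1 + j`.
  have h2 : ∀ j : ℕ, ∑' l : ℤ, (((w : ℂ) + l) ^ (ν + 1))⁻¹ * ((A / (w + l)) ^ j / j !) =
      ∑' n : ℕ, A ^ j / j ! *
      ((-2 * Real.pi * I) ^ (ν + j + 1) / (ν + j)! * (n ^ (ν + j) * e w ^ n)) := fun j ↦ by
    rw [tsum_mul_left, tsum_mul_left]
    have h := EisensteinSeries.qExpansion_identity (k := ν + j) (by lia) w
    rw [← e] at h
    rw [← h, ← tsum_mul_left]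
    refine tsum_congr fun l ↦ ?_
    rw [div_pow, show ν + j + 1 = ν + 1 + j by ring, pow_add _ (ν + 1) j, one_div, mul_inv]
    ring
  have hs2 := summable_lipschitz_bessel ν w A
  calc _ = ∑' l : ℤ, ∑' j : ℕ, (((w : ℂ) + l) ^ (ν + 1))⁻¹ * ((A / (w + l)) ^ j / j !) :=
        tsum_congr h1
    _ = ∑' j : ℕ, ∑' l : ℤ, (((w : ℂ) + l) ^ (ν + 1))⁻¹ * ((A / (w + l)) ^ j / j !) :=
        Summable.tsum_comm (f := fun (l : ℤ) (j : ℕ) ↦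
          (((w : ℂ) + l) ^ (ν + 1))⁻¹ * ((A / (w + l)) ^ j / j !)) hs1 |>.symm
    _ = ∑' j : ℕ, ∑' n : ℕ, A ^ j / j ! *
      ((-2 * Real.pi * I) ^ (ν + j + 1) / (ν + j)! * (n ^ (ν + j) * e w ^ n)) := tsum_congr h2
    _ = ∑' n : ℕ, ∑' j : ℕ, A ^ j / j ! *
      ((-2 * Real.pi * I) ^ (ν + j + 1) / (ν + j)! * (n ^ (ν + j) * e w ^ n)) :=
        Summable.tsum_comm (f := fun (j n : ℕ) ↦ A ^ j / j ! *
      ((-2 * Real.pi * I) ^ (ν + j + 1) / (ν + j)! * (n ^ (ν + j) * e w ^ n))) hs2 |>.symm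
    _ = _ := by
        refine tsum_congr fun n ↦ ?_
        rw [besselF, ← tsum_mul_left, ← tsum_mul_right, ← tsum_mul_left]
        refine tsum_congr fun j ↦ ?_
        rw [mul_pow _ (n : ℂ), mul_pow _ A, pow_add _ ν j, show ν + j + 1 = ν + 1 + j by ring,
          pow_add _ (ν + 1) j]
        field_simp

end PoincareSeries
end

/-! ### From cosets to bottom rows -/

section
open Filter Topology Complex

namespace PoincareSeries

theorem e_add (z w : ℂ) : e (z + w) = e z * e w := by
  rw [e, e, e, ← Complex.exp_add]; ring_nf

theorem e_int (n : ℤ) : e n = 1 := by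
  rw [e, mul_comm, Complex.exp_int_mul_two_pi_mul_I]

theorem e_natCast_mul (n : ℕ) (z : ℂ) : e (n * z) = e z ^ n := by
  rw [e, e, ← Complex.exp_nat_mul]; ring_nf

/-- The phase `e(ma/c)`, where `a` is an inverse of `d` modulo `c`. -/
noncomputable def phase (m : ℕ) (c d : ℤ) : ℂ :=
  open Classical in if IsCoprime c d then e (m * (Int.gcdA d c / c)) else 0

theorem phase_eq {m : ℕ} {c d a b : ℤ} (hc : c ≠ 0) (h : a * d - b * c = 1) :
    phase m c d = e (m * (a / c)) := by
  have hcop : IsCoprime c d := ⟨-b, a, by linarith⟩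
  have h1 : (1 : ℤ) = d * d.gcdA c + c * d.gcdB c := by
    rw [← Int.gcd_eq_gcd_ab, Int.isCoprime_iff_gcd_eq_one.mp hcop.symm]; rfl
  have h2 : d.gcdA c = a + (-(b * d.gcdA c) - a * d.gcdB c) * c := by
    linear_combination (-d.gcdA c) * h - a * h1
  rw [phase, if_pos hcop, h2]
  have hc' : (c : ℂ) ≠ 0 := by exact_mod_cast hc
  generalize -(b * d.gcdA c) - a * d.gcdB c = t
  have : (m * (((a + t * c : ℤ) : ℂ) / c)) = m * (a / c) + (m * t : ℤ) := by
    push_cast; field_simp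
  rw [this, e_add, e_int, mul_one]

theorem phase_add_mul (m : ℕ) {c : ℤ} (hc : c ≠ 0) (d l : ℤ) :
    phase m c (d + c * l) = phase m c d := by
  by_cases h : IsCoprime c d
  · obtain ⟨u, v, huv⟩ := h
    rw [phase_eq (a := v) (b := v * l - u) hc (by linear_combination huv),
      phase_eq (a := v) (b := -u) hc (by linear_combination huv)]
  · rw [phase, phase, if_neg h, if_neg (by rwa [IsCoprime.add_mul_left_right_iff])]

theorem norm_phase_le_one (m : ℕ) (c d : ℤ) : ‖phase m c d‖ ≤ 1 := by
  rw [phase]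
  split_ifs
  · rw [norm_e]
    have : ((m : ℂ) * (Int.gcdA d c / c)).im = 0 := by
      rw [show ((m : ℂ) * (Int.gcdA d c / c)) = ((m * (Int.gcdA d c / c) : ℝ) : ℂ) by push_cast; rfl,
        Complex.ofReal_im]
    simp [this]
  · simp

/-- The summand of the Poincaré series attached to the bottom row `(c, d)`, extended by zero to
the pairs that are not coprime. -/
noncomputable def rowTerm (k m : ℕ) (z : ℍ) (p : ℤ × ℤ) : ℂ :=
  open Classical in
  if p.1 = 0 then (if IsUnit p.2 then e (m * z) else 0) else
    phase m p.1 p.2 * (((p.1 : ℂ) * z + p.2) ^ k)⁻¹ *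
      exp (-(2 * Real.pi * I * m) / (p.1 * (p.1 * z + p.2)))

/-- For `c ≠ 0` this is `γz = a/c - 1/(c(cz+d))`; for `c = 0` one has `d = ±1`, and even weight
removes the sign. -/
theorem term_eq_rowTerm {k : ℕ} (hk : Even k) (m : ℕ) (z : ℍ) (γ : SL(2, ℤ)) :
    term k m z γ = rowTerm k m z (γ 1 0, γ 1 1) := by
  have hdet : γ 0 0 * γ 1 1 - γ 0 1 * γ 1 0 = 1 := by
    rw [← Matrix.det_fin_two]; exact γ.det_coe
  have hact : ((γ • z : ℍ) : ℂ) = (γ 0 0 * z + γ 0 1) / (γ 1 0 * z + γ 1 1) := by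
    rw [UpperHalfPlane.specialLinearGroup_apply]
    simp
  have hden : ((γ 1 0 : ℤ) : ℂ) * z + (γ 1 1 : ℤ) ≠ 0 := by
    rw [← ModularGroup.denom_apply]
    exact UpperHalfPlane.denom_ne_zero _ z
  rw [term, j, hact, zpow_neg, zpow_natCast]
  by_cases hc : γ 1 0 = 0
  · rw [rowTerm, if_pos hc]
    rw [hc, mul_zero, sub_zero] at hdet
    have hu : IsUnit (γ 1 1) := .of_mul_eq_one (γ 0 0) (by rw [mul_comm]; exact hdet)
    rw [if_pos hu, hc]
    rcases Int.isUnit_iff.mp hu with h | h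
    · have ha : γ 0 0 = 1 := by rw [h] at hdet; lia
      have : (m : ℂ) * ((γ 0 0 * z + γ 0 1) / ((0 : ℤ) * z + γ 1 1)) = m * z + (m * γ 0 1 : ℤ) := by
        rw [h, ha]; push_cast; ring
      rw [this, e_add, e_int, h]
      simp
    · have ha : γ 0 0 = -1 := by rw [h] at hdet; lia
      have : (m : ℂ) * ((γ 0 0 * z + γ 0 1) / ((0 : ℤ) * z + γ 1 1)) = m * z + (-m * γ 0 1 : ℤ) := by
        rw [h, ha]; push_cast; ring
      rw [this, e_add, e_int, h]
      simp [hk.neg_one_pow]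
  · rw [rowTerm, if_neg hc]
    dsimp only
    have hc' : (γ 1 0 : ℂ) ≠ 0 := by exact_mod_cast hc
    have hdet' : (γ 0 0 : ℂ) * γ 1 1 - γ 0 1 * γ 1 0 = 1 := by exact_mod_cast hdet
    have h1 : (m : ℂ) * ((γ 0 0 * z + γ 0 1) / (γ 1 0 * z + γ 1 1)) =
        m * (γ 0 0 / γ 1 0) + -(m / (γ 1 0 * (γ 1 0 * z + γ 1 1))) := by
      have h0 : (γ 0 0 * z + γ 0 1 : ℂ) / (γ 1 0 * z + γ 1 1) =
          γ 0 0 / γ 1 0 - 1 / (γ 1 0 * (γ 1 0 * z + γ 1 1)) := by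
        rw [div_sub_div _ _ hc' (mul_ne_zero hc' hden), div_eq_div_iff hden (by positivity)]
        linear_combination (-(γ 1 0 : ℂ) * (γ 1 0 * z + γ 1 1)) * hdet'
      rw [h0]
      ring
    rw [phase_eq hc hdet, h1, e_add]
    have h2 : e (-(m / (γ 1 0 * (γ 1 0 * z + γ 1 1)))) =
        exp (-(2 * Real.pi * I * m) / (γ 1 0 * (γ 1 0 * z + γ 1 1))) := by
      rw [e]; congr 1; ring
    rw [h2]
    ring

/-- The bottom row of a coset. -/
def bottomRow : Cosets 1 → ℤ × ℤ :=
  Quotient.lift (fun γ : CongruenceSubgroup.Gamma0 1 ↦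
    ((γ : SL(2, ℤ)) 1 0, (γ : SL(2, ℤ)) 1 1)) (by
    intro a b hab
    have h : b * a⁻¹ ∈ GammaInfty.subgroupOf (CongruenceSubgroup.Gamma0 1) :=
      QuotientGroup.rightRel_apply.mp hab
    have h' : (b : SL(2, ℤ)) * (a : SL(2, ℤ))⁻¹ ∈ GammaInfty := by
      simpa [Subgroup.mem_subgroupOf] using h
    obtain ⟨h00, h10, h11⟩ := h'
    have hb : (b : SL(2, ℤ)) = ((b : SL(2, ℤ)) * (a : SL(2, ℤ))⁻¹) * a := by simp
    rw [hb]
    generalize (b : SL(2, ℤ)) * (a : SL(2, ℤ))⁻¹ = u at *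
    simp [Matrix.mul_apply, Fin.sum_univ_two, *])

theorem bottomRow_injective : Function.Injective bottomRow := by
  intro x y
  induction x using Quotient.inductionOn with | _ a
  induction y using Quotient.inductionOn with | _ b
  intro h
  obtain ⟨h10, h11⟩ : (a : SL(2, ℤ)) 1 0 = (b : SL(2, ℤ)) 1 0 ∧
    (a : SL(2, ℤ)) 1 1 = (b : SL(2, ℤ)) 1 1 := Prod.ext_iff.mp h
  refine Quotient.sound (QuotientGroup.rightRel_apply.mpr ?_)
  rw [Subgroup.mem_subgroupOf]
  have da : (a : SL(2, ℤ)) 0 0 * (a : SL(2, ℤ)) 1 1 - (a : SL(2, ℤ)) 0 1 * (a : SL(2, ℤ)) 1 0 = 1 := by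
    rw [← Matrix.det_fin_two]; exact (a : SL(2, ℤ)).det_coe
  have db : (b : SL(2, ℤ)) 0 0 * (b : SL(2, ℤ)) 1 1 - (b : SL(2, ℤ)) 0 1 * (b : SL(2, ℤ)) 1 0 = 1 := by
    rw [← Matrix.det_fin_two]; exact (b : SL(2, ℤ)).det_coe
  rw [h10, h11] at da
  refine ⟨?_, ?_, ?_⟩ <;>
    simp [Matrix.SpecialLinearGroup.coe_inv, Matrix.adjugate_fin_two, Matrix.mul_apply,
      Fin.sum_univ_two, h10, h11] <;> linarith

theorem cosetTerm_eq_rowTerm {k : ℕ} (hk : Even k) (m : ℕ) (z : ℍ) (x : Cosets 1) :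
    cosetTerm k m 1 z x = rowTerm k m z (bottomRow x) := by
  induction x using Quotient.inductionOn with | _ a
  exact term_eq_rowTerm hk m z a

theorem support_rowTerm_subset (k m : ℕ) (z : ℍ) :
    Function.support (rowTerm k m z) ⊆ Set.range bottomRow := by
  rintro ⟨c, d⟩ h
  have hcop : IsCoprime c d := by
    by_contra hcd
    apply h
    by_cases hc : c = 0
    · rw [rowTerm, if_pos hc, if_neg]
      rwa [hc, isCoprime_zero_left] at hcd
    · rw [rowTerm, if_neg hc, phase, if_neg hcd, zero_mul, zero_mul]
  obtain ⟨γ, -, hγ⟩ := ModularGroup.bottom_row_surj (R := ℤ) (a := ![c, d]) (by simpa using hcop)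
  refine ⟨Quotient.mk _ ⟨γ, by simp [CongruenceSubgroup.Gamma0_mem, eq_iff_true_of_subsingleton]⟩, ?_⟩
  have h0 := congr_fun hγ 0
  have h1 := congr_fun hγ 1
  exact Prod.ext h0 h1

theorem summable_cosetTerm_iff {k : ℕ} (hk : Even k) (m : ℕ) (z : ℍ) :
    Summable (cosetTerm k m 1 z) ↔ Summable (rowTerm k m z) := by
  rw [← bottomRow_injective.summable_iff (f := rowTerm k m z)
    (fun x hx ↦ Function.notMem_support.mp fun h ↦ hx (support_rowTerm_subset k m z h))]
  exact summable_congr (cosetTerm_eq_rowTerm hk m z)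

theorem P_eq_tsum_rowTerm {k : ℕ} (hk : Even k) (m : ℕ) (z : ℍ) :
    P k m 1 z = ∑' p, rowTerm k m z p := by
  rw [P, ← bottomRow_injective.tsum_eq (support_rowTerm_subset k m z)]
  exact tsum_congr (cosetTerm_eq_rowTerm hk m z)

/-- The summands of the Poincaré series are bounded by those of the Eisenstein series. -/
theorem norm_rowTerm_le {k : ℕ} (hk : Even k) (m : ℕ) (z : ℍ) (p : ℤ × ℤ) :
    ‖rowTerm k m z p‖ ≤ ‖(((p.1 : ℂ) * z + p.2) ^ k)⁻¹‖ := by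
  by_cases h : p ∈ Function.support (rowTerm k m z)
  · obtain ⟨x, rfl⟩ := support_rowTerm_subset k m z h
    induction x using Quotient.inductionOn with | _ a
    rw [← cosetTerm_eq_rowTerm hk]
    change ‖j a z ^ (-(k : ℤ)) * e (m * (((a : SL(2, ℤ)) • z : ℍ) : ℂ))‖ ≤ ‖(j a z ^ k)⁻¹‖
    rw [norm_mul, zpow_neg, zpow_natCast, e_natCast_mul, norm_pow]
    -- `γz` stays in the upper half-plane, so the exponential has absolute value at most `1`.
    exact mul_le_of_le_one_right (norm_nonneg _)
      (pow_le_one₀ (norm_nonneg _) (norm_e_lt_one _).le)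
  · rw [Function.notMem_support.mp h, norm_zero]
    exact norm_nonneg _

theorem summable_rowTerm {k : ℕ} (hk : Even k) (hk3 : 3 ≤ k) (m : ℕ) (z : ℍ) :
    Summable (rowTerm k m z) := by
  refine Summable.of_norm_bounded (summable_prod_eisSummand hk3 z).norm fun p ↦ ?_
  simpa [EisensteinSeries.eisSummand, zpow_neg] using norm_rowTerm_le hk m z p

end PoincareSeries
end

/-! ### The Fourier expansion of the Poincaré series -/

section
open Filter Topology Complex

namespace PoincareSeries

theorem tsum_int_eq_sum_range {f : ℤ → ℂ} (hf : Summable f) {c : ℤ} (hc : c ≠ 0) :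
    ∑' d, f d = ∑ r ∈ Finset.range c.natAbs, ∑' l : ℤ, f (r + c * l) := by
  have : NeZero c.natAbs := ⟨Int.natAbs_ne_zero.mpr hc⟩
  let E := Int.divModEquiv c.natAbs
  have hs : Summable fun p : ℤ × Fin c.natAbs ↦ f (p.2 + c.natAbs * p.1) := by
    refine (E.symm.summable_iff.mpr hf).congr fun p ↦ ?_
    simp [E, Int.divModEquiv_symm_apply, mul_comm, add_comm]
  have h1 : ∑' d, f d = ∑' p : ℤ × Fin c.natAbs, f (p.2 + c.natAbs * p.1) := by
    rw [← E.symm.tsum_eq f]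
    refine tsum_congr fun p ↦ ?_
    simp [E, Int.divModEquiv_symm_apply, mul_comm, add_comm]
  rw [h1, hs.tsum_prod, ← Summable.tsum_comm (f := fun (l : ℤ) (r : Fin c.natAbs) ↦
    f (r + c.natAbs * l)) hs, tsum_fintype, Finset.sum_range]
  refine Finset.sum_congr rfl fun r _ ↦ ?_
  rcases Int.natAbs_eq c with h | h
  · rw [← h]
  -- For negative `c`, the substitution `l ↦ -l` turns steps of `|c|` into steps of `c`.
  · rw [← (Equiv.neg ℤ).tsum_eq]
    refine tsum_congr fun l ↦ ?_
    congr 2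
    rw [Equiv.neg_apply, mul_neg, ← neg_mul, ← h]

/-- The contribution of the bottom rows `(c, *)` to the `n`-th Fourier coefficient of the Poincaré
series of weight `ν + 1` and index `m`. -/
noncomputable def fourierTerm (ν m : ℕ) (c : ℤ) (n : ℕ) : ℂ :=
  if c = 0 then (if n = m then 2 else 0) else
    (-2 * Real.pi * I) ^ (ν + 1) * n ^ ν * ((c : ℂ) ^ (ν + 1))⁻¹ *
      besselF ν (-(4 * Real.pi ^ 2 * m * n / c ^ 2 : ℝ)) *
      ∑ r ∈ Finset.range c.natAbs, phase m c r * e (r / c) ^ n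

theorem summable_lipschitz {ν : ℕ} (w : ℍ) (s : ℝ) :
    Summable fun n : ℕ ↦ (-2 * Real.pi * I) ^ (ν + 1) * (n ^ ν * besselF ν (-(s * n : ℝ)) * e w ^ n) := by
  obtain ⟨ε, hε, hlt⟩ := exists_pos_exp_mul_lt_one (a := |s|) (norm_e_lt_one w)
  have h2 : Summable fun n : ℕ ↦ (n : ℝ) ^ ν * (Real.exp (ε * |s|) * ‖e w‖) ^ n :=
    summable_pow_mul_geometric_of_norm_lt_one ν (by rwa [Real.norm_of_nonneg (by positivity)])
  refine Summable.mul_left _ (Summable.of_norm_bounded (h2.mul_left (Real.exp (1 / ε))) fun n ↦ ?_)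
  have h3 := norm_besselF_le ν (-(s * n : ℝ)) hε
  have h4 : Real.exp (ε * ‖(-(s * n : ℝ) : ℂ)‖) = Real.exp (ε * |s|) ^ n := by
    rw [norm_neg, Complex.norm_real, norm_mul, Real.norm_natCast, Real.norm_eq_abs,
      ← Real.exp_nat_mul]
    ring_nf
  rw [h4] at h3
  rw [norm_mul, norm_mul, norm_pow, norm_pow, Complex.norm_natCast]
  calc _ ≤ (n : ℝ) ^ ν * (Real.exp (1 / ε) * Real.exp (ε * |s|) ^ n) * ‖e w‖ ^ n := by gcongr
    _ = _ := by rw [mul_pow]; ring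

theorem tsum_rowTerm_of_ne_zero {ν : ℕ} (hν : 2 ≤ ν) (hk : Even (ν + 1)) (m : ℕ) (z : ℍ) {c : ℤ}
    (hc : c ≠ 0) :
    ∑' d, rowTerm (ν + 1) m z (c, d) = ∑' n, fourierTerm ν m c n * e z ^ n := by
  have hc' : (c : ℂ) ≠ 0 := by exact_mod_cast hc
  have hs := (summable_rowTerm hk (by lia) m z).prod_factor c
  rw [tsum_int_eq_sum_range hs hc]
  -- On the class `d = r + cl` the phase is constant and `cz + d = c(w r + l)`, so Lipschitz'
  -- formula applies at `w r`.
  let w : ℕ → ℍ := fun r ↦ ((r / c : ℝ) +ᵥ z)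
  have hw : ∀ r, ((w r : ℍ) : ℂ) = z + r / c := fun r ↦ by
    simp [w, add_comm]
  have h1 : ∀ (r : ℕ) (l : ℤ), rowTerm (ν + 1) m z (c, r + c * l) =
      phase m c r * ((c : ℂ) ^ (ν + 1))⁻¹ *
        ((((w r : ℂ) + l) ^ (ν + 1))⁻¹ * exp (-(2 * Real.pi * I * m / c ^ 2) / (w r + l))) := by
    intro r l
    have h0 : (c : ℂ) * z + (r + c * l : ℤ) = c * (w r + l) := by
      rw [hw]; push_cast; field_simp; ring
    rw [rowTerm, if_neg hc, phase_add_mul m hc]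
    dsimp only
    rw [h0, mul_pow, mul_inv]
    have h5 : -(2 * Real.pi * I * m) / (c * (c * ((w r : ℂ) + l))) =
        -(2 * Real.pi * I * m / c ^ 2) / (w r + l) := by
      rw [← neg_div, div_div]; ring_nf
    rw [h5]
    ring
  have h2 : ∀ n : ℕ, -2 * Real.pi * I * -(2 * Real.pi * I * m / c ^ 2) * n =
      (-(4 * Real.pi ^ 2 * m / c ^ 2 * n : ℝ) : ℂ) := fun n ↦ by
    push_cast
    linear_combination (4 * Real.pi ^ 2 * m / c ^ 2 * n : ℂ) * I_sq
  have h3 : ∀ r : ℕ, ∑' l : ℤ, rowTerm (ν + 1) m z (c, r + c * l) =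
      ∑' n : ℕ, phase m c r * ((c : ℂ) ^ (ν + 1))⁻¹ * ((-2 * Real.pi * I) ^ (ν + 1) *
        (n ^ ν * besselF ν (-(4 * Real.pi ^ 2 * m / c ^ 2 * n : ℝ)) * e (w r) ^ n)) := by
    intro r
    simp_rw [h1, tsum_mul_left]
    rw [tsum_inv_pow_mul_exp_div (by lia)]
    simp_rw [h2, tsum_mul_left]
  rw [Finset.sum_congr rfl fun r _ ↦ h3 r, ← Summable.tsum_finsetSum fun r _ ↦
    (summable_lipschitz (w r) _).mul_left _]
  refine tsum_congr fun n ↦ ?_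
  rw [fourierTerm, if_neg hc, Finset.mul_sum, Finset.sum_mul]
  refine Finset.sum_congr rfl fun r _ ↦ ?_
  rw [hw, e_add, mul_pow, show 4 * Real.pi ^ 2 * m / (c : ℝ) ^ 2 * n = 4 * Real.pi ^ 2 * m * n / c ^ 2 by
    ring]
  ring

theorem tsum_rowTerm_zero {ν m : ℕ} (z : ℍ) :
    ∑' d, rowTerm (ν + 1) m z (0, d) = ∑' n, fourierTerm ν m 0 n * e z ^ n := by
  have h1 : ∑' n, fourierTerm ν m 0 n * e z ^ n = 2 * e z ^ m := by
    rw [tsum_eq_single m fun n hn ↦ by simp [fourierTerm, hn]]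
    simp [fourierTerm]
  rw [h1, tsum_eq_sum (s := {1, -1}) fun d hd ↦ ?_]
  -- Both rows `(0, 1)` and `(0, -1)` occur, since `Γ_∞` does not contain `-I`; hence the diagonal
  -- coefficient `2`.
  · simp [rowTerm, e_natCast_mul, two_mul]
  · simp only [Finset.mem_insert, Finset.mem_singleton, not_or] at hd
    simp [rowTerm, Int.isUnit_iff, hd]

/-- The Kloosterman sum is bounded trivially by `|c|`, which costs one power of `c`. -/
theorem norm_fourierTerm_le {ν m : ℕ} {c : ℤ} (hc : c ≠ 0) (n : ℕ) :
    ‖fourierTerm ν m c n‖ ≤ (2 * Real.pi) ^ (ν + 1) * n ^ ν * (|(c : ℝ)| ^ ν)⁻¹ *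
      ‖besselF ν (-(4 * Real.pi ^ 2 * m * n / c ^ 2 : ℝ))‖ := by
  have hc' : (0 : ℝ) < |(c : ℝ)| := by positivity
  have h1 : ‖∑ r ∈ Finset.range c.natAbs, phase m c r * e (r / c) ^ n‖ ≤ |(c : ℝ)| := by
    refine (norm_sum_le_of_le (n := fun _ ↦ 1) _ fun r _ ↦ ?_).trans ?_
    · have h2 : ‖e (r / c)‖ = 1 := by
        rw [norm_e, show ((r : ℂ) / c) = ((r / c : ℝ) : ℂ) by push_cast; rfl, Complex.ofReal_im]
        simp
      rw [norm_mul, norm_pow, h2, one_pow, mul_one]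
      exact norm_phase_le_one _ _ _
    · simp [Nat.cast_natAbs]
  have hpi : ‖(-2 * Real.pi * I : ℂ)‖ = 2 * Real.pi := by simp [abs_of_pos Real.pi_pos]
  rw [fourierTerm, if_neg hc, norm_mul, norm_mul, norm_mul, norm_mul, norm_pow, hpi, norm_pow,
    norm_inv, norm_pow, Complex.norm_natCast, Complex.norm_intCast]
  calc _ ≤ (2 * Real.pi) ^ (ν + 1) * n ^ ν * (|(c : ℝ)| ^ (ν + 1))⁻¹ *
      ‖besselF ν (-(4 * Real.pi ^ 2 * m * n / c ^ 2 : ℝ))‖ * |(c : ℝ)| := by gcongr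
    _ = _ := by rw [pow_succ |(c : ℝ)|]; field_simp

theorem summable_inv_abs_int_pow {ν : ℕ} (hν : 2 ≤ ν) :
    Summable fun c : ℤ ↦ (|(c : ℝ)| ^ ν)⁻¹ := by
  refine ((Real.summable_one_div_int_pow (p := ν)).mpr (by lia)).norm.congr fun c ↦ ?_
  simp

theorem summable_fourierTerm {ν : ℕ} (hν : 2 ≤ ν) (m : ℕ) (z : ℍ) :
    Summable fun p : ℤ × ℕ ↦ fourierTerm ν m p.1 p.2 * e z ^ p.2 := by
  obtain ⟨ε, hε, hlt⟩ := exists_pos_exp_mul_lt_one (a := 4 * Real.pi ^ 2 * m) (norm_e_lt_one z)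
  set ρ := Real.exp (ε * (4 * Real.pi ^ 2 * m)) with hρ
  have h2 : Summable fun n : ℕ ↦ (n : ℝ) ^ ν * (ρ * ‖e z‖) ^ n :=
    summable_pow_mul_geometric_of_norm_lt_one ν (by rwa [Real.norm_of_nonneg (by positivity)])
  -- The majorant is a product in `c` and `n`, uniform because `c² ≥ 1`, plus a single point for the
  -- diagonal term at `c = 0`.
  have h3 := (((summable_inv_abs_int_pow hν).mul_of_nonneg h2 (fun _ ↦ by positivity)
    (fun _ ↦ by positivity)).mul_left ((2 * Real.pi) ^ (ν + 1) * Real.exp (1 / ε))).add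
    (summable_of_hasFiniteSupport (f := fun p : ℤ × ℕ ↦ if p = (0, m) then (2 : ℝ) else 0)
      ((Set.finite_singleton (0, m)).subset (by intro p; simp)))
  refine Summable.of_norm_bounded h3 fun ⟨c, n⟩ ↦ ?_
  by_cases hc : c = 0
  · subst hc
    refine le_add_of_nonneg_of_le (by positivity) ?_
    by_cases hn : n = m
    · simp only [fourierTerm, hn, if_true, norm_mul, norm_pow]
      simpa using pow_le_one₀ (norm_nonneg _) (norm_e_lt_one z).le
    · simp [fourierTerm, hn]
  · refine le_add_of_le_of_nonneg ?_ (by positivity)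
    have hc1 : (1 : ℝ) ≤ (c : ℝ) ^ 2 := by
      rw [← sq_abs]
      exact one_le_pow₀ (by exact_mod_cast Int.one_le_abs hc)
    have h4 := norm_besselF_le ν (-(4 * Real.pi ^ 2 * m * n / c ^ 2 : ℝ)) hε
    have h5 : Real.exp (ε * ‖(-(4 * Real.pi ^ 2 * m * n / c ^ 2 : ℝ) : ℂ)‖) ≤ ρ ^ n := by
      rw [hρ, ← Real.exp_nat_mul, norm_neg, Complex.norm_real, Real.norm_of_nonneg (by positivity)]
      refine Real.exp_le_exp.mpr ?_
      calc _ ≤ ε * (4 * Real.pi ^ 2 * m * n) := by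
            gcongr; exact div_le_self (by positivity) hc1
        _ = _ := by ring
    dsimp only
    rw [norm_mul, norm_pow]
    calc _ ≤ (2 * Real.pi) ^ (ν + 1) * n ^ ν * (|(c : ℝ)| ^ ν)⁻¹ * (Real.exp (1 / ε) * ρ ^ n) *
          ‖e z‖ ^ n := by
          gcongr
          refine (norm_fourierTerm_le hc n).trans ?_
          gcongr
          exact h4.trans (by gcongr)
      _ = _ := by rw [mul_pow]; ring

theorem hasSum_P {ν : ℕ} (hν : 2 ≤ ν) (hk : Even (ν + 1)) (m : ℕ) (z : ℍ) :
    HasSum (fun n ↦ (∑' c, fourierTerm ν m c n) * e z ^ n) (P (ν + 1) m 1 z) := by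
  have hs := summable_fourierTerm hν m z
  have h1 : P (ν + 1) m 1 z = ∑' p : ℤ × ℕ, fourierTerm ν m p.1 p.2 * e z ^ p.2 := by
    rw [P_eq_tsum_rowTerm hk, (summable_rowTerm hk (by lia) m z).tsum_prod, hs.tsum_prod]
    refine tsum_congr fun c ↦ ?_
    by_cases hc : c = 0
    · rw [hc]; exact tsum_rowTerm_zero z
    · exact tsum_rowTerm_of_ne_zero hν hk m z hc
  have h2 := hs.prod_symm
  have h3 := h2.hasSum.prod_fiberwise fun n ↦ (h2.prod_factor n).hasSum
  simp only [Prod.fst_swap, Prod.snd_swap, tsum_mul_right] at h3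
  rw [h1, ← (Equiv.prodComm ℕ ℤ).tsum_eq]
  exact h3

theorem qExpansion_P_coeff {ν : ℕ} (hν : 2 ≤ ν) (hk : Even (ν + 1)) (m n : ℕ) :
    (UpperHalfPlane.qExpansion 1 (P (ν + 1) m 1)).coeff n = ∑' c, fourierTerm ν m c n :=
  qExpansion_coeff_of_hasSum (hasSum_P hν hk m) n

end PoincareSeries
end

/-! ### Nonvanishing of the first coefficient -/

section
open Filter Topology Complex
open scoped Nat

namespace PoincareSeries

theorem tsum_int_inv_abs_pow_four : ∑' c : ℤ, (|(c : ℝ)| ^ 4)⁻¹ = Real.pi ^ 4 / 45 := by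
  rw [tsum_int_eq_zero_add_two_mul_tsum_pnat (fun n ↦ by simp) (summable_inv_abs_int_pow (by lia))]
  have h1 : ∑' n : ℕ+, (1 : ℝ) / (n : ℝ) ^ 4 = Real.pi ^ 4 / 90 := by
    have h := tsum_zero_pnat_eq_tsum_nat hasSum_zeta_four.summable
    rwa [hasSum_zeta_four.tsum_eq, Nat.cast_zero, zero_pow (by lia), div_zero, zero_add] at h
  have h2 : ∑' n : ℕ+, (|((n : ℤ) : ℝ)| ^ 4)⁻¹ = Real.pi ^ 4 / 90 := by
    rw [← h1]
    exact tsum_congr fun n ↦ by simp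
  rw [h2]
  norm_num
  ring

theorem tsum_compl_inv_abs_pow_four_le :
    ∑' c : ↑((({0, 1, -1} : Finset ℤ) : Set ℤ)ᶜ), (|((c : ℤ) : ℝ)| ^ 4)⁻¹ ≤ 0.165 := by
  have h := (summable_inv_abs_int_pow (ν := 4) (by lia)).sum_add_tsum_compl (s := {0, 1, -1})
  rw [tsum_int_inv_abs_pow_four] at h
  have h2 : ∑ c ∈ ({0, 1, -1} : Finset ℤ), (|(c : ℝ)| ^ 4)⁻¹ = 2 := by norm_num
  rw [h2] at h
  have h3 : Real.pi ^ 4 ≤ 3.1416 ^ 4 := by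
    gcongr; exact Real.pi_lt_d4.le
  norm_num at h3 ⊢
  linarith

theorem inv_abs_pow_le {c : ℤ} (hc : 2 ≤ |c|) {ν : ℕ} (hν : 4 ≤ ν) :
    (|(c : ℝ)| ^ ν)⁻¹ ≤ 16 * (2 ^ ν)⁻¹ * (|(c : ℝ)| ^ 4)⁻¹ := by
  have hc' : (2 : ℝ) ≤ |(c : ℝ)| := by exact_mod_cast hc
  obtain ⟨l, rfl⟩ := Nat.exists_eq_add_of_le hν
  rw [pow_add, pow_add, mul_inv, mul_inv]
  calc _ ≤ (|(c : ℝ)| ^ 4)⁻¹ * (2 ^ l)⁻¹ := by gcongr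
    _ = _ := by ring

theorem fourierTerm_zero {ν m : ℕ} (hν : ν ≠ 0) (hm : m ≠ 0) (c : ℤ) : fourierTerm ν m c 0 = 0 := by
  by_cases hc : c = 0
  · simp [fourierTerm, hc, hm.symm]
  · simp [fourierTerm, hc, hν]

theorem norm_fourierTerm_one_le {ν m : ℕ} (ht : 16 * Real.pi ^ 2 * m ≤ (ν : ℝ) ^ 2) {c : ℤ}
    (hc : c ≠ 0) :
    ‖fourierTerm ν m c 1‖ ≤ (2 * Real.pi) ^ (ν + 1) / ν ! * (|(c : ℝ)| ^ ν)⁻¹ := by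
  have h := norm_fourierTerm_le (ν := ν) (m := m) hc 1
  have hc1 : (1 : ℝ) ≤ (c : ℝ) ^ 2 := by
    rw [← sq_abs]
    exact one_le_pow₀ (by exact_mod_cast Int.one_le_abs hc)
  have h1 : 4 * (4 * Real.pi ^ 2 * m * (1 : ℕ) / (c : ℝ) ^ 2) ≤ (ν + 1) * (ν + 2) := by
    have : 4 * Real.pi ^ 2 * m * (1 : ℕ) / (c : ℝ) ^ 2 ≤ 4 * Real.pi ^ 2 * m * (1 : ℕ) :=
      div_le_self (by positivity) hc1
    push_cast at this ⊢
    nlinarith [show (0 : ℝ) ≤ ν from ν.cast_nonneg]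
  obtain ⟨h2, h3⟩ := besselG_bounds (by positivity) h1
  have h4 : 0 ≤ besselG ν (4 * Real.pi ^ 2 * m * (1 : ℕ) / (c : ℝ) ^ 2) :=
    le_trans (by positivity) h2
  rw [besselF_neg_ofReal, Complex.norm_real, Real.norm_of_nonneg (by positivity), Nat.cast_one,
    one_pow, mul_one] at h
  rw [Nat.cast_one] at h3
  refine h.trans ?_
  calc _ ≤ (2 * Real.pi) ^ (ν + 1) * (|(c : ℝ)| ^ ν)⁻¹ * (1 / ν !) := by gcongr
    _ = _ := by ring

theorem fourierTerm_isUnit {ν m : ℕ} (hk : Even (ν + 1)) {c : ℤ} (hc : IsUnit c) :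
    fourierTerm ν m c 1 =
      (-2 * Real.pi * I) ^ (ν + 1) / ν ! * besselG ν (4 * Real.pi ^ 2 * m) := by
  have h : c ≠ 0 := hc.ne_zero
  have h1 : phase m c 0 = 1 := by
    rw [phase_eq (a := 0) (b := -c) h (by rw [← Int.isUnit_mul_self hc]; ring)]
    simp [e]
  have h2 : c.natAbs = 1 := Int.isUnit_iff_natAbs_eq.mp hc
  have h3 : ((c : ℂ) ^ (ν + 1)) = 1 := by
    rcases Int.isUnit_iff.mp hc with rfl | rfl
    · simp
    · simpa using hk.neg_one_pow
  have h4 : (c : ℝ) ^ 2 = 1 := by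
    rcases Int.isUnit_iff.mp hc with rfl | rfl <;> simp
  rw [fourierTerm, if_neg h, h2, h3, h4, besselF_neg_ofReal]
  simp [h1, e]
  ring

/-- The first Fourier coefficient is the sum of the contributions of `c = 0` and `c = ±1`, up to
a small error. -/
theorem norm_tsum_fourierTerm_one_sub_le {ν m : ℕ} (hν : 4 ≤ ν) (hk : Even (ν + 1))
    (ht : 16 * Real.pi ^ 2 * m ≤ (ν : ℝ) ^ 2) :
    ‖∑' c, fourierTerm ν m c 1 - (if 1 = m then 2 else 0) -
      2 * ((-2 * Real.pi * I) ^ (ν + 1) / ν ! * besselG ν (4 * Real.pi ^ 2 * m))‖ ≤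
      (2 * Real.pi) ^ (ν + 1) / ν ! * (2.64 * (2 ^ ν)⁻¹) := by
  set K : ℝ := (2 * Real.pi) ^ (ν + 1) / (ν ! : ℕ)
  have hs : Summable fun c : ℤ ↦ fourierTerm ν m c 1 := by
    -- Any point would do: the slice `n = 1` of the double series at `z = i` is divided by `e(i) ≠
    -- 0`.
    have h := (summable_fourierTerm (by lia : 2 ≤ ν) m UpperHalfPlane.I).prod_symm.prod_factor 1
    have he : e UpperHalfPlane.I ≠ 0 := Complex.exp_ne_zero _
    refine (summable_mul_right_iff he).mp (h.congr fun c ↦ ?_)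
    rw [Prod.swap_prod_mk, pow_one]
  have h1 := hs.sum_add_tsum_compl (s := {0, 1, -1})
  have h2 : ∑ c ∈ ({0, 1, -1} : Finset ℤ), fourierTerm ν m c 1 = (if 1 = m then 2 else 0) +
      2 * ((-2 * Real.pi * I) ^ (ν + 1) / ν ! * besselG ν (4 * Real.pi ^ 2 * m)) := by
    rw [Finset.sum_insert (by decide), Finset.sum_insert (by decide), Finset.sum_singleton,
      fourierTerm_isUnit hk isUnit_one, fourierTerm_isUnit hk isUnit_one.neg, two_mul]
    simp [fourierTerm]
  have hs4 := (summable_inv_abs_int_pow (ν := 4) (by lia)).subtype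
    (((({0, 1, -1} : Finset ℤ) : Set ℤ)ᶜ))
  have h3 := tsum_of_norm_bounded ((hs4.mul_left (K * (16 * (2 ^ ν)⁻¹))).hasSum)
    (f := fun c : ↑((({0, 1, -1} : Finset ℤ) : Set ℤ)ᶜ) ↦ fourierTerm ν m c 1) (by
      rintro ⟨c, hc⟩
      simp only [Finset.coe_insert, Finset.coe_singleton, Set.mem_compl_iff, Set.mem_insert_iff,
        Set.mem_singleton_iff, not_or] at hc
      have h5 : 2 ≤ |c| := by
        obtain ⟨a, b, d⟩ := hc
        rcases abs_cases c with ⟨h, h'⟩ | ⟨h, h'⟩ <;> lia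
      have h6 := inv_abs_pow_le h5 hν
      refine (norm_fourierTerm_one_le ht hc.1).trans ?_
      rw [mul_assoc]
      exact mul_le_mul_of_nonneg_left h6 (by positivity))
  rw [← h1, h2, sub_sub, add_sub_cancel_left]
  refine h3.trans ?_
  rw [tsum_mul_left]
  calc _ ≤ K * (16 * (2 ^ ν)⁻¹) * 0.165 := by
        gcongr
        exact tsum_compl_inv_abs_pow_four_le
    _ = _ := by ring

theorem le_besselG {ν m : ℕ} (hν : 1 ≤ ν) (ht : 16 * Real.pi ^ 2 * m ≤ (ν : ℝ) ^ 2) :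
    1.4 * (2 ^ ν)⁻¹ ≤ besselG ν (4 * Real.pi ^ 2 * m) ∧ besselG ν (4 * Real.pi ^ 2 * m) ≤ 1 := by
  have hν' : (1 : ℝ) ≤ ν := by exact_mod_cast hν
  obtain ⟨h1, h2⟩ := besselG_bounds (ν := ν) (t := 4 * Real.pi ^ 2 * m) (by positivity)
    (by nlinarith)
  refine ⟨le_trans ?_ h1, h2⟩
  -- `ν²/(ν+1) ≤ ν - 1/2` for `ν ≥ 1`. The saved `1/2` gives the factor `√2 ≥ 1.4`, without which
  -- the terms `c = ±1` would not exceed the tail bound.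
  have h3 : 4 * (4 * Real.pi ^ 2 * m) / (ν + 1) ≤ ν - 1 / 2 := by
    rw [div_le_iff₀ (by positivity)]
    nlinarith
  calc (1.4 : ℝ) * (2 ^ ν)⁻¹ ≤ √2 * (2 ^ ν)⁻¹ := by
        gcongr
        exact Real.le_sqrt_of_sq_le (by norm_num)
    _ = 2 ^ (-(ν - 1 / 2 : ℝ)) := by
        rw [Real.sqrt_eq_rpow, ← Real.rpow_natCast, ← Real.rpow_neg (by norm_num),
          ← Real.rpow_add (by norm_num)]
        ring_nf
    _ ≤ _ := Real.rpow_le_rpow_of_exponent_le (by norm_num) (by linarith)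

theorem tsum_fourierTerm_one_ne_zero {ν m : ℕ} (hν : 4 ≤ ν) (hk : Even (ν + 1))
    (hK : (2 * Real.pi) ^ (ν + 1) / ν ! < 2 / 5)
    (ht : 16 * Real.pi ^ 2 * m ≤ (ν : ℝ) ^ 2) : ∑' c, fourierTerm ν m c 1 ≠ 0 := by
  intro h0
  have h := norm_tsum_fourierTerm_one_sub_le hν hk ht
  obtain ⟨h1, h2⟩ := le_besselG (by lia) ht
  have hp : (0 : ℝ) < (2 ^ ν)⁻¹ := by positivity
  have hp1 : ((2 : ℝ) ^ ν)⁻¹ ≤ 1 := inv_le_one_of_one_le₀ (one_le_pow₀ (by norm_num))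
  have hKpos : 0 < (2 * Real.pi) ^ (ν + 1) / (ν ! : ℝ) := by positivity
  have hn : ‖2 * ((-2 * Real.pi * I) ^ (ν + 1) / ν ! * besselG ν (4 * Real.pi ^ 2 * m))‖ =
      2 * ((2 * Real.pi) ^ (ν + 1) / ν ! * besselG ν (4 * Real.pi ^ 2 * m)) := by
    have hpi : ‖(-2 * Real.pi * I : ℂ)‖ = 2 * Real.pi := by simp [abs_of_pos Real.pi_pos]
    rw [norm_mul, norm_mul, norm_div, norm_pow, hpi, Complex.norm_natCast, Complex.norm_real,
      Real.norm_of_nonneg (by linarith), Complex.norm_ofNat]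
  set X : ℂ := 2 * ((-2 * Real.pi * I) ^ (ν + 1) / ν ! * besselG ν (4 * Real.pi ^ 2 * m))
  set K : ℝ := (2 * Real.pi) ^ (ν + 1) / (ν ! : ℕ)
  set G := besselG ν (4 * Real.pi ^ 2 * m)
  set p : ℝ := (2 ^ ν)⁻¹
  rw [h0] at h
  split_ifs at h with hm
  -- Case `m = 1`: vanishing would force `2 ≤ 4.64 K`, but `K < 2/5`.
  · have h3 : (2 : ℝ) ≤ ‖(0 - 2 - X : ℂ)‖ + ‖X‖ := by
      calc (2 : ℝ) = ‖(-(0 - 2 - X) - X : ℂ)‖ := by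
            rw [show (-(0 - 2 - X) - X : ℂ) = 2 by ring]; simp
        _ ≤ _ := by
            refine (norm_sub_le _ _).trans ?_
            rw [norm_neg]
    have h4 := mul_le_of_le_one_right hKpos.le h2
    have h5 := mul_le_of_le_one_right hKpos.le hp1
    have h6 : (2 : ℝ) ≤ K * (2.64 * p) + 2 * (K * G) := by
      rw [← hn]
      exact h3.trans (add_le_add_left h _)
    linarith
  -- Case `m ≠ 1`: vanishing would force `2.8 K 2^(-ν) ≤ 2.64 K 2^(-ν)`.
  · rw [sub_zero, zero_sub, norm_neg, hn] at h
    nlinarith [mul_le_mul_of_nonneg_left h1 hKpos.le, mul_pos hKpos hp]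

end PoincareSeries
end

/-! ### The main theorem -/

theorem mainTheorem2 :
    ∃ k₀ : ℕ, ∀ k : ℕ, k₀ ≤ k → Even k →
      ∀ m : ℕ, 1 ≤ m → (m : ℝ) ≤ ((k : ℝ) - 1) ^ 2 / (16 * Real.pi ^ 2) →
        (∀ z : UpperHalfPlane, Summable (PoincareSeries.cosetTerm k m 1 z)) ∧
        PoincareSeries.vInfty (PoincareSeries.P k m 1) = 1 ∧
        ∃ z : UpperHalfPlane, PoincareSeries.P k m 1 z ≠ 0 := by
  have hlim : Filter.Tendsto (fun ν : ℕ ↦ (2 * Real.pi) ^ (ν + 1) / (ν.factorial : ℝ)) Filter.atTop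
      (nhds 0) := by
    have h := (FloorSemiring.tendsto_pow_div_factorial_atTop (2 * Real.pi)).const_mul (2 * Real.pi)
    rw [mul_zero] at h
    exact h.congr fun ν ↦ by rw [pow_succ]; ring
  obtain ⟨N, hN⟩ := Filter.eventually_atTop.mp
    (hlim.eventually (gt_mem_nhds (show (0 : ℝ) < 2 / 5 by norm_num)))
  -- This makes `ν = k - 1` at least both `N` and `4`; the latter allows comparison of the tail with
  -- `ζ(4)`.
  refine ⟨N + 5, fun k hk heven m hm hmk ↦ ?_⟩
  obtain ⟨ν, rfl⟩ : ∃ ν, k = ν + 1 := ⟨k - 1, by lia⟩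
  have ht : 16 * Real.pi ^ 2 * m ≤ (ν : ℝ) ^ 2 := by
    rw [le_div_iff₀ (by positivity)] at hmk
    push_cast at hmk
    rw [add_sub_cancel_right] at hmk
    linarith
  have h0 : (UpperHalfPlane.qExpansion 1 (PoincareSeries.P (ν + 1) m 1)).coeff 0 = 0 := by
    rw [PoincareSeries.qExpansion_P_coeff (by lia) heven]
    simp [PoincareSeries.fourierTerm_zero (show ν ≠ 0 by lia) (show m ≠ 0 by lia)]
  have h1 : (UpperHalfPlane.qExpansion 1 (PoincareSeries.P (ν + 1) m 1)).coeff 1 ≠ 0 := by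
    rw [PoincareSeries.qExpansion_P_coeff (by lia) heven]
    exact PoincareSeries.tsum_fourierTerm_one_ne_zero (by lia) heven (hN ν (by lia)) ht
  refine ⟨fun z ↦ (PoincareSeries.summable_cosetTerm_iff heven m z).mpr
    (PoincareSeries.summable_rowTerm heven (by lia) m z), ?_, ?_⟩
  · rw [PoincareSeries.vInfty]
    refine (PowerSeries.order_eq_nat (n := 1)).mpr ⟨h1, fun i hi ↦ ?_⟩
    rw [Nat.lt_one_iff.mp hi, h0]
  · by_contra! hzero
    apply h1
    rw [show PoincareSeries.P (ν + 1) m 1 = 0 from funext hzero, UpperHalfPlane.qExpansion_zero,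
      map_zero]
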